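/- Let $R$ be a commutative artinian ring and let $A$ be an artin $R$-algebra, that is, an (associative, unital) $R$-algebra which is finitely generated as an $R$-module. Assume that $A$ is connected, i.e. $0$ and $1$ are the only central idempotents of $A$, and that $\mathbf r^2=0$, where $\mathbf r$ is the Jacobson radical of $A$. Then $A$ is self-injective or CM-free (possibly both). Here $A$ is self-injective if the regular left module ${}_AA$ is injective, and CM-free if a finitely generated left $A$-module is Gorenstein-projective if and only if it is projective. A finitely generated left $A$-module $M$ is called Gorenstein-projective if there is an exact complex $P^\bullet=(\cdots\to P^{-1}\xrightarrow{d^{-1}}P^0\xrightarrow{d^0}P^1\to\cdots)$ of finitely generated projective left $A$-modules such that the complex $\operatorname{Hom}_A(P^\bullet,A)$ is also exact and $M\cong\ker d^0$. -/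

import Mathlib

open CategoryTheory

universe u

/-- `A` is connected: it is not a product of two nonzero rings, i.e. its only central idempotents
are `0` and `1`. (The zero ring is not excluded.) -/
def IsConnectedAlgebra (A : Type u) [Ring A] : Prop :=
  ∀ e ∈ Subring.center A, IsIdempotentElem e → e = 0 ∨ e = 1

/-- A totally acyclic complex of finitely generated projective left `A`-modules: the complex `P` is
exact, and so is the complex `Hom_A(P, A)`, whose differentials are precomposition with those
of `P`. -/
structure IsTotallyAcyclic {A : Type u} [Ring A] (P : CochainComplex (ModuleCat.{u} A) ℤ) :
    Prop where
  finite : ∀ n : ℤ, Module.Finite A (P.X n)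
  projective : ∀ n : ℤ, Module.Projective A (P.X n)
  exact : ∀ n : ℤ, Function.Exact (P.d n (n + 1)).hom (P.d (n + 1) (n + 1 + 1)).hom
  exact_dual : ∀ n : ℤ, Function.Exact
    (fun f : P.X (n + 1 + 1) →ₗ[A] A => f ∘ₗ (P.d (n + 1) (n + 1 + 1)).hom)
    (fun f : P.X (n + 1) →ₗ[A] A => f ∘ₗ (P.d n (n + 1)).hom)

/-- `M` is finitely generated Gorenstein-projective: it is isomorphic to the `0`-th cocycle module
of a totally acyclic complex of finitely generated projective modules. (Such an `M` is finitely
generated, being the image of the differential ending in degree `0`.) -/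
def IsGorensteinProjective (A : Type u) [Ring A] (M : Type u) [AddCommGroup M] [Module A M] :
    Prop :=
  ∃ P : CochainComplex (ModuleCat.{u} A) ℤ, IsTotallyAcyclic P ∧
    Nonempty (M ≃ₗ[A] LinearMap.ker (P.d 0 1).hom)

/-- `A` is CM-free: the finitely generated Gorenstein-projective left modules are exactly the
finitely generated projective ones. (Every finitely generated `A`-module is isomorphic to one in
the universe of `A`.) -/
def IsCMFree (A : Type u) [Ring A] : Prop :=
  ∀ (M : Type u) [AddCommGroup M] [Module A M] [Module.Finite A M],
    IsGorensteinProjective A M ↔ Module.Projective A M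

/-- `A` is self-injective: the left regular module is injective. -/
def IsSelfInjective (A : Type u) [Ring A] : Prop := Module.Injective A A

/-!
Let `r` be the Jacobson radical. A Gorenstein-projective module `M` satisfies `Ext^n(M, A) = 0` for
all `n ≥ 1`. As `r² = 0`, the kernel of a projective cover of `M` is semisimple, and if `M` is not
projective then any simple submodule of this syzygy is *acyclic*: it is not projective, and all its
higher extension groups into `A` vanish. So `A` is CM-free unless there is an acyclic simple module.

The syzygy of an acyclic simple module is again an acyclic simple module, and determines the former.
Since there are only finitely many simple modules, every acyclic simple module is therefore the
syzygy of one. Let `I` and `K` be the common annihilators of the simple modules which are,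
respectively are not, acyclic. Then `I ⊓ K ≤ r` and `I ⊔ K = A`. Moreover `I r K = 0`, because
`I r` kills the projective covers of the acyclic simple modules, and `K r I = 0`, because the maps
from acyclic simple modules to `A` take values in the left annihilator of `I`. Hence `A = I² ⊕ K²`
as rings, and connectedness forces either all or none of the simple modules to be acyclic. If all
are, then `Ext¹(S, A) = 0` for every simple module `S`, and `A` is injective by Baer's criterion.
-/

open Abelian

section Ext

variable {C : Type*} [Category C] [Abelian C] [HasExt C] {X Y B : C} {S : ShortComplex C}

theorem subsingleton_ext_of_retract (r : Retract X Y) (n : ℕ) [Subsingleton (Ext Y B n)] :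
    Subsingleton (Ext X B n) := by
  refine subsingleton_of_forall_eq 0 fun x ↦ ?_
  calc x = (Ext.mk₀ r.i).comp ((Ext.mk₀ r.r).comp x (zero_add n)) (zero_add n) := by
        rw [Ext.mk₀_comp_mk₀_assoc, r.retract, Ext.mk₀_id_comp]
    _ = 0 := by rw [Subsingleton.elim ((Ext.mk₀ r.r).comp x _) 0, Ext.comp_zero]

theorem exists_comp_eq_of_subsingleton_ext_one (hS : S.ShortExact)
    [Subsingleton (Ext S.X₃ B 1)] (f : S.X₁ ⟶ B) : ∃ g : S.X₂ ⟶ B, S.f ≫ g = f := by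
  obtain ⟨y, hy⟩ := Ext.contravariant_sequence_exact₁ hS B (Ext.mk₀ f) (add_zero 1)
    (Subsingleton.elim _ _)
  obtain ⟨g, rfl⟩ := (Ext.mk₀_bijective _ _).surjective y
  rw [Ext.mk₀_comp_mk₀] at hy
  exact ⟨g, (Ext.mk₀_bijective _ _).injective hy⟩

theorem subsingleton_ext_one_of_exists_comp_eq (hS : S.ShortExact) [Projective S.X₂]
    (h : ∀ f : S.X₁ ⟶ B, ∃ g : S.X₂ ⟶ B, S.f ≫ g = f) : Subsingleton (Ext S.X₃ B 1) := by
  refine subsingleton_of_forall_eq 0 fun x ↦ ?_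
  obtain ⟨y, rfl⟩ := Ext.contravariant_sequence_exact₃ hS B x (Ext.eq_zero_of_projective _)
    (add_zero 1)
  obtain ⟨f, rfl⟩ := (Ext.mk₀_bijective _ _).surjective y
  obtain ⟨g, rfl⟩ := h f
  rw [← Ext.mk₀_comp_mk₀]
  exact hS.extClass_comp_assoc _

theorem subsingleton_ext_add_two_iff (hS : S.ShortExact) [Projective S.X₂] (n : ℕ) :
    Subsingleton (Ext S.X₃ B (n + 2)) ↔ Subsingleton (Ext S.X₁ B (n + 1)) := by
  have hn : 1 + (n + 1) = n + 2 := add_comm _ _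
  refine ⟨fun _ ↦ subsingleton_of_forall_eq 0 fun x ↦ ?_,
    fun _ ↦ subsingleton_of_forall_eq 0 fun x ↦ ?_⟩
  · obtain ⟨y, rfl⟩ := Ext.contravariant_sequence_exact₁ hS B x hn (Subsingleton.elim _ _)
    rw [Ext.eq_zero_of_projective y, Ext.comp_zero]
  · obtain ⟨y, rfl⟩ := Ext.contravariant_sequence_exact₃ hS B x (Ext.eq_zero_of_projective _) hn
    rw [Subsingleton.elim y 0, Ext.comp_zero]

end Ext

section ModuleExt

variable {A : Type u} [Ring A] {M N P B : Type u} [AddCommGroup M] [Module A M]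
  [AddCommGroup N] [Module A N] [AddCommGroup P] [Module A P] [AddCommGroup B] [Module A B]

theorem exists_comp_subtype_eq_of_subsingleton_ext_one {p : P →ₗ[A] M}
    (hp : Function.Surjective p) [Subsingleton (Ext (ModuleCat.of A M) (ModuleCat.of A B) 1)]
    (f : LinearMap.ker p →ₗ[A] B) : ∃ g : P →ₗ[A] B, g ∘ₗ (LinearMap.ker p).subtype = f := by
  obtain ⟨g, hg⟩ := exists_comp_eq_of_subsingleton_ext_one
    (LinearMap.shortExact_shortComplexKer hp) (ModuleCat.ofHom f)
  exact ⟨g.hom, congrArg ModuleCat.Hom.hom hg⟩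

theorem subsingleton_ext_one_of_exists_comp_subtype_eq [Module.Projective A P] {p : P →ₗ[A] M}
    (hp : Function.Surjective p)
    (h : ∀ f : LinearMap.ker p →ₗ[A] B, ∃ g : P →ₗ[A] B, g ∘ₗ (LinearMap.ker p).subtype = f) :
    Subsingleton (Ext (ModuleCat.of A M) (ModuleCat.of A B) 1) := by
  have : Projective (ModuleCat.of A P) := (IsProjective.iff_projective P).1 inferInstance
  refine subsingleton_ext_one_of_exists_comp_eq (LinearMap.shortExact_shortComplexKer hp)
    fun f ↦ ?_
  obtain ⟨g, hg⟩ := h f.hom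
  exact ⟨ModuleCat.ofHom g, ModuleCat.hom_ext hg⟩

theorem subsingleton_ext_add_two_iff_ker [Module.Projective A P] {p : P →ₗ[A] M}
    (hp : Function.Surjective p) (n : ℕ) :
    Subsingleton (Ext (ModuleCat.of A M) (ModuleCat.of A B) (n + 2)) ↔
      Subsingleton (Ext (ModuleCat.of A (LinearMap.ker p)) (ModuleCat.of A B) (n + 1)) :=
  have : Projective (ModuleCat.of A P) := (IsProjective.iff_projective P).1 inferInstance
  subsingleton_ext_add_two_iff (LinearMap.shortExact_shortComplexKer hp) n

/-- `M` is semi-Gorenstein-projective: all higher extension groups `Ext^n(M, A)`, `n ≥ 1`, into the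
regular module vanish. -/
def IsSemiGorensteinProjective (A : Type u) [Ring A] (M : Type u) [AddCommGroup M] [Module A M] :
    Prop :=
  ∀ n : ℕ, Subsingleton (Ext (ModuleCat.of A M) (ModuleCat.of A A) (n + 1))

namespace IsSemiGorensteinProjective

theorem of_retract (h : IsSemiGorensteinProjective A M) (i : N →ₗ[A] M) (r : M →ₗ[A] N)
    (hri : r ∘ₗ i = LinearMap.id) : IsSemiGorensteinProjective A N := fun n ↦
  have := h n
  subsingleton_ext_of_retract
    ⟨ModuleCat.ofHom i, ModuleCat.ofHom r, ModuleCat.hom_ext hri⟩ (n + 1)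

theorem of_linearEquiv (h : IsSemiGorensteinProjective A M) (e : M ≃ₗ[A] N) :
    IsSemiGorensteinProjective A N :=
  h.of_retract e.symm.toLinearMap e.toLinearMap e.comp_symm

theorem ker (h : IsSemiGorensteinProjective A M) [Module.Projective A P] {p : P →ₗ[A] M}
    (hp : Function.Surjective p) : IsSemiGorensteinProjective A (LinearMap.ker p) := fun n ↦
  (subsingleton_ext_add_two_iff_ker hp n).1 (h (n + 1))

theorem exists_comp_subtype_eq (h : IsSemiGorensteinProjective A M) {p : P →ₗ[A] M}
    (hp : Function.Surjective p) [Module.Finite A B] [Module.Projective A B]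
    (f : LinearMap.ker p →ₗ[A] B) : ∃ g : P →ₗ[A] B, g ∘ₗ (LinearMap.ker p).subtype = f := by
  have := h 0
  obtain ⟨n, r, i, -, -, hri⟩ := Module.Finite.exists_comp_eq_id_of_projective A B
  choose g hg using fun j : Fin n ↦
    exists_comp_subtype_eq_of_subsingleton_ext_one hp (LinearMap.proj j ∘ₗ i ∘ₗ f)
  have hext : LinearMap.pi g ∘ₗ (LinearMap.ker p).subtype = i ∘ₗ f :=
    LinearMap.ext fun x ↦ funext fun j ↦ LinearMap.congr_fun (hg j) x
  exact ⟨r ∘ₗ LinearMap.pi g, by rw [LinearMap.comp_assoc, hext, ← LinearMap.comp_assoc, hri,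
    LinearMap.id_comp]⟩

end IsSemiGorensteinProjective

end ModuleExt

section Complex

variable {A : Type u} [Ring A] {P : CochainComplex (ModuleCat.{u} A) ℤ}

/-- The differential of a complex, corestricted to the cocycles. -/
def toCocycles (P : CochainComplex (ModuleCat.{u} A) ℤ) (n : ℤ) :
    P.X n →ₗ[A] LinearMap.ker (P.d (n + 1) (n + 1 + 1)).hom :=
  (P.d n (n + 1)).hom.codRestrict _ fun x ↦
    congrArg (fun f ↦ ModuleCat.Hom.hom f x) (P.d_comp_d n (n + 1) (n + 1 + 1))

theorem ker_toCocycles (n : ℤ) :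
    LinearMap.ker (toCocycles P n) = LinearMap.ker (P.d n (n + 1)).hom :=
  LinearMap.ker_codRestrict _ _ _

namespace IsTotallyAcyclic

theorem toCocycles_surjective (hP : IsTotallyAcyclic P) (n : ℤ) :
    Function.Surjective (toCocycles P n) := by
  rintro ⟨y, hy⟩
  obtain ⟨x, hx⟩ := (hP.exact n y).1 hy
  exact ⟨x, Subtype.ext hx⟩

theorem exists_comp_subtype_eq (hP : IsTotallyAcyclic P) (n : ℤ)
    (f : LinearMap.ker (P.d (n + 1 + 1) (n + 1 + 1 + 1)).hom →ₗ[A] A) :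
    ∃ g : P.X (n + 1 + 1) →ₗ[A] A, g ∘ₗ Submodule.subtype _ = f := by
  have hcocycle : (f ∘ₗ toCocycles P (n + 1)) ∘ₗ (P.d n (n + 1)).hom = 0 := by
    have hzero : toCocycles P (n + 1) ∘ₗ (P.d n (n + 1)).hom = 0 :=
      LinearMap.ext fun x ↦ Subtype.ext (toCocycles P n x).2
    rw [LinearMap.comp_assoc, hzero, LinearMap.comp_zero]
  obtain ⟨g, hg⟩ := (hP.exact_dual n _).1 hcocycle
  refine ⟨g, LinearMap.ext fun z ↦ ?_⟩
  obtain ⟨x, rfl⟩ := hP.toCocycles_surjective (n + 1) z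
  exact LinearMap.congr_fun hg x

theorem isSemiGorensteinProjective_ker (hP : IsTotallyAcyclic P) (n : ℤ) :
    IsSemiGorensteinProjective A (LinearMap.ker (P.d n (n + 1)).hom) := by
  intro k
  induction k generalizing n with
  | zero =>
    obtain ⟨m, rfl⟩ : ∃ m, n = m + 1 + 1 + 1 := ⟨n - 3, by ring⟩
    have := hP.projective (m + 1 + 1)
    refine subsingleton_ext_one_of_exists_comp_subtype_eq (hP.toCocycles_surjective _) ?_
    rw [ker_toCocycles]
    exact hP.exists_comp_subtype_eq m
  | succ k ih =>
    obtain ⟨m, rfl⟩ : ∃ m, n = m + 1 := ⟨n - 1, by ring⟩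
    have := hP.projective m
    refine (subsingleton_ext_add_two_iff_ker (hP.toCocycles_surjective m) k).2 ?_
    rw [ker_toCocycles]
    exact ih m

end IsTotallyAcyclic

theorem IsGorensteinProjective.isSemiGorensteinProjective {M : Type u} [AddCommGroup M]
    [Module A M] (h : IsGorensteinProjective A M) : IsSemiGorensteinProjective A M := by
  obtain ⟨P, hP, ⟨e⟩⟩ := h
  exact (hP.isSemiGorensteinProjective_ker 0).of_linearEquiv e.symm

variable (M : Type u) [AddCommGroup M] [Module A M]

/-- The contractible complex with all terms `M × M` and all differentials `(a, b) ↦ (b, 0)`. Each of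
its cocycle modules is a copy of `M`. -/
noncomputable def shiftComplex (A M : Type u) [Ring A] [AddCommGroup M] [Module A M] :
    CochainComplex (ModuleCat.{u} A) ℤ :=
  CochainComplex.of (fun _ ↦ ModuleCat.of A (M × M))
    (fun _ ↦ ModuleCat.ofHom (LinearMap.inl A M M ∘ₗ LinearMap.snd A M M))
    (fun _ ↦ by ext x <;> simp)

theorem shiftComplex_d (n : ℤ) :
    ((shiftComplex A M).d n (n + 1)).hom = LinearMap.inl A M M ∘ₗ LinearMap.snd A M M :=
  congrArg ModuleCat.Hom.hom (CochainComplex.of_d (fun _ : ℤ ↦ ModuleCat.of A (M × M))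
    (fun _ ↦ ModuleCat.ofHom (LinearMap.inl A M M ∘ₗ LinearMap.snd A M M)) n)

theorem ker_inl_comp_snd : LinearMap.ker (LinearMap.inl A M M ∘ₗ LinearMap.snd A M M) =
    LinearMap.range (LinearMap.inl A M M) := by
  rw [LinearMap.ker_comp_of_ker_eq_bot _ (LinearMap.ker_eq_bot.2 LinearMap.inl_injective),
    LinearMap.range_inl]

theorem range_inl_comp_snd : LinearMap.range (LinearMap.inl A M M ∘ₗ LinearMap.snd A M M) =
    LinearMap.range (LinearMap.inl A M M) :=
  LinearMap.range_comp_of_range_eq_top _ Submodule.range_snd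

theorem isTotallyAcyclic_shiftComplex [Module.Finite A M] [Module.Projective A M] :
    IsTotallyAcyclic (shiftComplex A M) where
  finite _ := inferInstanceAs (Module.Finite A (M × M))
  projective _ := inferInstanceAs (Module.Projective A (M × M))
  exact n := by
    rw [shiftComplex_d, shiftComplex_d]
    have h : Function.Exact (LinearMap.inl A M M ∘ₗ LinearMap.snd A M M)
        (LinearMap.inl A M M ∘ₗ LinearMap.snd A M M) :=
      LinearMap.exact_iff.2 ((ker_inl_comp_snd M).trans (range_inl_comp_snd M).symm)
    exact h
  exact_dual n := by
    rw [shiftComplex_d, shiftComplex_d]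
    intro (f : M × M →ₗ[A] A)
    constructor
    · intro h
      refine ⟨f ∘ₗ LinearMap.inr A M M ∘ₗ LinearMap.fst A M M, ?_⟩
      refine LinearMap.prod_ext (LinearMap.ext fun a ↦ ?_) rfl
      exact (map_zero f).trans (LinearMap.congr_fun h (0, a)).symm
    · rintro ⟨g, rfl⟩
      exact LinearMap.ext fun _ ↦ map_zero g

theorem IsGorensteinProjective.of_projective [Module.Finite A M] [Module.Projective A M] :
    IsGorensteinProjective A M := by
  have hd : LinearMap.ker ((shiftComplex A M).d 0 1).hom =
      LinearMap.range (LinearMap.inl A M M) :=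
    (congrArg LinearMap.ker (shiftComplex_d M 0)).trans (ker_inl_comp_snd M)
  refine ⟨shiftComplex A M, isTotallyAcyclic_shiftComplex M, ⟨?_⟩⟩
  rw [hd]
  exact LinearEquiv.ofInjective _ LinearMap.inl_injective

end Complex

section SimpleModule

variable {A : Type u} [Ring A] {M T : Type u} [AddCommGroup M] [Module A M]
  [AddCommGroup T] [Module A T]

theorem isSemisimpleModule_of_jacobson_le_annihilator [IsSemisimpleRing (A ⧸ Ring.jacobson A)]
    (h : Ring.jacobson A ≤ Module.annihilator A M) : IsSemisimpleModule A M := by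
  have hM : Module.IsTorsionBySet A M (Ring.jacobson A) :=
    (Module.isTorsionBySet_iff_subset_annihilator A M).2 h
  let := hM.module
  exact hM.isSemisimpleModule_iff.1 inferInstance

theorem jacobson_smul_top_le_ker [IsSemisimpleModule A T] (f : M →ₗ[A] T) :
    Ring.jacobson A • (⊤ : Submodule A M) ≤ LinearMap.ker f := by
  refine Submodule.smul_le.2 fun a ha x _ ↦ ?_
  rw [LinearMap.mem_ker, map_smul,
    Module.mem_annihilator.1 (IsSemisimpleModule.jacobson_le_annihilator A T ha)]

theorem le_annihilator_quotient {I m : Ideal A} [I.IsTwoSided] (h : I ≤ m) :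
    I ≤ Module.annihilator A (A ⧸ m) := by
  refine fun a ha ↦ Module.mem_annihilator.2 fun y ↦ ?_
  obtain ⟨x, rfl⟩ := m.mkQ_surjective y
  rw [← map_smul, smul_eq_mul, Submodule.mkQ_apply, Submodule.Quotient.mk_eq_zero]
  exact h (I.mul_mem_right x ha)

theorem annihilator_quotient_le (I : Ideal A) : Module.annihilator A (A ⧸ I) ≤ I := fun a ha ↦ by
  rw [← Submodule.Quotient.mk_eq_zero, ← Module.mem_annihilator.1 ha (I.mkQ 1), ← map_smul,
    smul_eq_mul, mul_one, Submodule.mkQ_apply]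

theorem exists_injective_linearMap_quotient_of_le_annihilator {I : Ideal A}
    [IsSemisimpleModule A (A ⧸ I)] [IsSimpleModule A T] (h : I ≤ Module.annihilator A T) :
    ∃ j : T →ₗ[A] A ⧸ I, Function.Injective j := by
  obtain ⟨t, ht⟩ := @exists_ne T (IsSimpleModule.nontrivial A T) 0
  have hI : I ≤ LinearMap.ker (LinearMap.toSpanSingleton A T t) := fun a ha ↦
    Module.mem_annihilator.1 (h ha) t
  have hsurj : Function.Surjective (I.liftQ _ hI) := fun s ↦
    (IsSimpleModule.toSpanSingleton_surjective A ht s).imp' I.mkQ fun _ h ↦ h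
  obtain ⟨j, hj⟩ := IsSemisimpleModule.lifting_property _ hsurj LinearMap.id
  exact ⟨j, Function.LeftInverse.injective (LinearMap.congr_fun hj)⟩

theorem exists_linearEquiv_of_iInf_annihilator_le [IsSemisimpleRing (A ⧸ Ring.jacobson A)]
    {ι : Type*} (S : ι → Type u) [∀ i, AddCommGroup (S i)] [∀ i, Module A (S i)]
    [∀ i, IsSimpleModule A (S i)] [IsSimpleModule A T]
    (h : ⨅ i, Module.annihilator A (S i) ≤ Module.annihilator A T) :
    ∃ i, Nonempty (T ≃ₗ[A] S i) := by
  set I := ⨅ i, Module.annihilator A (S i) with hI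
  have : IsSemisimpleModule A (A ⧸ I) :=
    isSemisimpleModule_of_jacobson_le_annihilator <| (le_annihilator_quotient le_rfl).trans' <|
      le_iInf fun i ↦ IsSemisimpleModule.jacobson_le_annihilator A (S i)
  obtain ⟨j, hj⟩ := exists_injective_linearMap_quotient_of_le_annihilator h
  obtain ⟨t, ht⟩ := @exists_ne T (IsSimpleModule.nontrivial A T) 0
  obtain ⟨a, ha⟩ := I.mkQ_surjective (j t)
  have haI : a ∉ I := fun haI ↦ (map_ne_zero_iff j hj).2 ht <| by
    rw [← ha, Submodule.mkQ_apply, (Submodule.Quotient.mk_eq_zero I).2 haI]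
  obtain ⟨i, s, hs⟩ : ∃ i, ∃ s : S i, a • s ≠ 0 := by
    simpa only [hI, Submodule.mem_iInf, Module.mem_annihilator, not_forall] using haI
  have hIs : I ≤ LinearMap.ker (LinearMap.toSpanSingleton A (S i) s) := fun b hb ↦
    Module.mem_annihilator.1 ((Submodule.mem_iInf _).1 hb i) s
  have hne : I.liftQ _ hIs ∘ₗ j ≠ 0 := fun h0 ↦ hs <| by
    have h0t := LinearMap.congr_fun h0 t
    rwa [LinearMap.comp_apply, ← ha] at h0t
  exact ⟨i, ⟨LinearEquiv.ofBijective _ (LinearMap.bijective_of_ne_zero hne)⟩⟩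

theorem exists_lt_nonempty_linearEquiv [IsArtinianRing A] (S : ℕ → Type u) [∀ n, AddCommGroup (S n)]
    [∀ n, Module A (S n)] [∀ n, IsSimpleModule A (S n)] :
    ∃ i j, i < j ∧ Nonempty (S i ≃ₗ[A] S j) := by
  let I (n : ℕ) : Ideal A := ⨅ k : Fin n, Module.annihilator A (S k)
  let n := Function.argmin I
  have hle : I (n + 1) ≤ I n := le_iInf fun k ↦ iInf_le_of_le k.castSucc le_rfl
  have hann : I n ≤ Module.annihilator A (S n) :=
    (eq_of_le_of_not_lt hle (Function.not_lt_argmin I _)).ge.trans (iInf_le _ (Fin.last n))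
  obtain ⟨k, ⟨e⟩⟩ := exists_linearEquiv_of_iInf_annihilator_le (fun k : Fin n ↦ S k) hann
  exact ⟨k, n, k.2, ⟨e.symm⟩⟩

end SimpleModule

section ProjectiveCover

variable {A : Type u} [Ring A] {P Q M S T : Type u} [AddCommGroup P] [Module A P]
  [AddCommGroup Q] [Module A Q] [AddCommGroup M] [Module A M] [AddCommGroup S] [Module A S]
  [AddCommGroup T] [Module A T]

/-- `π : P → M` is a projective cover: a surjection from a projective module whose kernel is
superfluous, i.e. has no supplement other than `P`. -/
structure IsProjectiveCover (π : P →ₗ[A] M) : Prop where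
  projective : Module.Projective A P
  surjective : Function.Surjective π
  superfluous : ∀ N : Submodule A P, N ⊔ LinearMap.ker π = ⊤ → N = ⊤

namespace IsProjectiveCover

variable {π : P →ₗ[A] M}

theorem surjective_of_comp (hπ : IsProjectiveCover π) {g : Q →ₗ[A] P}
    (h : Function.Surjective (π ∘ₗ g)) : Function.Surjective g := by
  refine LinearMap.range_eq_top.1 (hπ.superfluous _ ?_)
  rw [← LinearMap.map_eq_top_iff (LinearMap.range_eq_top.2 hπ.surjective), ← LinearMap.range_comp,
    LinearMap.range_eq_top.2 h]

theorem finite (hπ : IsProjectiveCover π) [Module.Finite A M] : Module.Finite A P := by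
  obtain ⟨n, f, hf⟩ := Module.Finite.exists_fin' A M
  obtain ⟨g, rfl⟩ := Module.projective_lifting_property π f hπ.surjective
  exact Module.Finite.of_surjective g (hπ.surjective_of_comp hf)

theorem ker_le_jacobson_smul_top (hπ : IsProjectiveCover π)
    [IsSemisimpleRing (A ⧸ Ring.jacobson A)] :
    LinearMap.ker π ≤ Ring.jacobson A • (⊤ : Submodule A P) := by
  have hker : LinearMap.ker π ≤ Module.jacobson A P := le_sInf fun N hN ↦ by
    by_contra hle
    exact hN.1 (hπ.superfluous N (hN.2 _ (left_lt_sup.2 hle)))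
  refine hker.trans (Module.jacobson_le_of_eq_bot ?_)
  have : IsSemisimpleModule A (P ⧸ Ring.jacobson A • (⊤ : Submodule A P)) := by
    refine isSemisimpleModule_of_jacobson_le_annihilator fun a ha ↦
      Module.mem_annihilator.2 fun y ↦ ?_
    obtain ⟨x, rfl⟩ := Submodule.mkQ_surjective _ y
    rw [← map_smul, Submodule.mkQ_apply, Submodule.Quotient.mk_eq_zero]
    exact Submodule.smul_mem_smul ha trivial
  exact IsSemisimpleModule.jacobson_eq_bot A _

theorem nonempty_linearEquiv [IsSemisimpleRing (A ⧸ Ring.jacobson A)] [IsSimpleModule A S]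
    [IsSimpleModule A T] {π : P →ₗ[A] S} (hπ : IsProjectiveCover π) {f : P →ₗ[A] T} (hf : f ≠ 0) :
    Nonempty (S ≃ₗ[A] T) := by
  have hle : LinearMap.ker π ≤ LinearMap.ker f :=
    hπ.ker_le_jacobson_smul_top.trans (jacobson_smul_top_le_ker f)
  have hker : LinearMap.ker π = LinearMap.ker f :=
    (((LinearMap.isCoatom_ker_of_surjective hπ.surjective).le_iff_eq
      (mt LinearMap.ker_eq_top.1 hf)).1 hle).symm
  exact ⟨(π.quotKerEquivOfSurjective hπ.surjective).symm ≪≫ₗ Submodule.quotEquivOfEq _ _ hker ≪≫ₗ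
    f.quotKerEquivOfSurjective (LinearMap.surjective_of_ne_zero hf)⟩

end IsProjectiveCover

/-- For `N` minimal with `N + ker π = Q`, a lift `Q → N` of `π` restricts to a surjective, hence
bijective, endomorphism of `N`; so `N` is a direct summand of `Q`. -/
theorem exists_isProjectiveCover (A : Type u) [Ring A] [IsArtinianRing A] (M : Type u)
    [AddCommGroup M] [Module A M] [Module.Finite A M] :
    ∃ (P : Type u) (_ : AddCommGroup P) (_ : Module A P) (π : P →ₗ[A] M),
      IsProjectiveCover π := by
  obtain ⟨n, π, hπ⟩ := Module.Finite.exists_fin' A M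
  obtain ⟨N, hN, hmin⟩ := exists_minimal_of_wellFoundedLT
    (fun N : Submodule A (Fin n → A) ↦ N.map π = ⊤)
    ⟨⊤, (Submodule.map_top π).trans (LinearMap.range_eq_top.2 hπ)⟩
  have hsurj : Function.Surjective (π ∘ₗ N.subtype) := by
    rwa [← LinearMap.range_eq_top, LinearMap.range_comp, Submodule.range_subtype]
  have eq_top_of_map (L : Submodule A N) (hL : L.map (π ∘ₗ N.subtype) = ⊤) : L = ⊤ := by
    rw [Submodule.map_comp] at hL
    have hle := Submodule.comap_mono (f := N.subtype) (hmin hL (Submodule.map_subtype_le N L))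
    rwa [Submodule.comap_subtype_self, Submodule.comap_map_eq_of_injective
      N.subtype_injective, top_le_iff] at hle
  obtain ⟨φ, hφ⟩ := Module.projective_lifting_property _ π hsurj
  have hφN : Function.Surjective (φ ∘ₗ N.subtype) := by
    refine LinearMap.range_eq_top.1 (eq_top_of_map _ ?_)
    rw [← LinearMap.range_comp, ← LinearMap.comp_assoc, hφ, LinearMap.range_eq_top.2 hsurj]
  let e := LinearEquiv.ofBijective (φ ∘ₗ N.subtype)
    ⟨IsNoetherian.injective_of_surjective_endomorphism _ hφN, hφN⟩
  refine ⟨N, inferInstance, inferInstance, π ∘ₗ N.subtype, ?_, hsurj, fun L hL ↦ ?_⟩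
  · exact Module.Projective.of_split N.subtype (e.symm.toLinearMap ∘ₗ φ)
      (LinearMap.ext e.symm_apply_apply)
  · exact eq_top_of_map L ((LinearMap.map_eq_top_iff (LinearMap.range_eq_top.2 hsurj)).2 hL)

end ProjectiveCover

section Syzygy

variable {A : Type u} [Ring A] {K K' P Q M S T : Type u} [AddCommGroup K] [Module A K]
  [AddCommGroup K'] [Module A K'] [AddCommGroup P] [Module A P] [AddCommGroup Q] [Module A Q]
  [AddCommGroup M] [Module A M] [AddCommGroup S] [Module A S] [AddCommGroup T] [Module A T]

theorem smul_eq_zero_of_mem_jacobson_smul_top (hJ : Ring.jacobson A * Ring.jacobson A = ⊥) {a : A}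
    (ha : a ∈ Ring.jacobson A) {x : M} (hx : x ∈ Ring.jacobson A • (⊤ : Submodule A M)) :
    a • x = 0 := by
  induction hx using Submodule.smul_induction_on' with
  | smul b hb y _ =>
    have hab : a * b = 0 := (Submodule.mem_bot A).1 (hJ ▸ Ideal.mul_mem_mul ha hb)
    rw [← mul_smul, hab, zero_smul]
  | add x _ y _ hx hy => rw [smul_add, hx, hy, add_zero]

namespace IsProjectiveCover

variable [IsSemisimpleRing (A ⧸ Ring.jacobson A)] {π : P →ₗ[A] M}

theorem isSemisimpleModule_ker (hπ : IsProjectiveCover π)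
    (hJ : Ring.jacobson A * Ring.jacobson A = ⊥) : IsSemisimpleModule A (LinearMap.ker π) :=
  isSemisimpleModule_of_jacobson_le_annihilator fun _ ha ↦ Module.mem_annihilator.2 fun x ↦
    Subtype.ext (smul_eq_zero_of_mem_jacobson_smul_top hJ ha (hπ.ker_le_jacobson_smul_top x.2))

theorem comp_ne_zero (hπ : IsProjectiveCover π) (hJ : Ring.jacobson A * Ring.jacobson A = ⊥)
    {g : Q →ₗ[A] P} {x : Q} (hx : x ∈ Ring.jacobson A • (⊤ : Submodule A Q)) (hgx : g x ≠ 0) :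
    π ∘ₗ g ≠ 0 := by
  refine fun h ↦ hgx ?_
  have hle : Ring.jacobson A • ⊤ ≤ LinearMap.ker g := Submodule.smul_le.2 fun a ha y _ ↦ by
    rw [LinearMap.mem_ker, map_smul]
    exact smul_eq_zero_of_mem_jacobson_smul_top hJ ha
      (hπ.ker_le_jacobson_smul_top (LinearMap.congr_fun h y))
  exact hle hx

theorem linearMap_ker_eq_zero (hπ : IsProjectiveCover π) (hM : IsSemiGorensteinProjective A M)
    [IsSemisimpleModule A T] [Module.Finite A T] [Module.Projective A T]
    (f : LinearMap.ker π →ₗ[A] T) : f = 0 := by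
  obtain ⟨g, rfl⟩ := hM.exists_comp_subtype_eq hπ.surjective f
  exact LinearMap.ext fun x ↦ jacobson_smul_top_le_ker g (hπ.ker_le_jacobson_smul_top x.2)

end IsProjectiveCover

/-- A lift of `f` to the covers is nonzero modulo the radical, because it does not kill the
submodule `ker π` of the radical. -/
theorem IsProjectiveCover.exists_surjective_comp_subtype_eq
    [IsSemisimpleRing (A ⧸ Ring.jacobson A)] (hJ : Ring.jacobson A * Ring.jacobson A = ⊥)
    {π : P →ₗ[A] S} {ρ : Q →ₗ[A] T} (hπ : IsProjectiveCover π) (hρ : IsProjectiveCover ρ)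
    [IsSimpleModule A T] (hS : IsSemiGorensteinProjective A S)
    {f : LinearMap.ker π →ₗ[A] LinearMap.ker ρ} (hf : f ≠ 0) :
    ∃ g : P →ₗ[A] Q, Function.Surjective g ∧
      g ∘ₗ (LinearMap.ker π).subtype = (LinearMap.ker ρ).subtype ∘ₗ f := by
  have := hρ.projective
  have := hρ.finite
  obtain ⟨g, hg⟩ := hS.exists_comp_subtype_eq hπ.surjective ((LinearMap.ker ρ).subtype ∘ₗ f)
  obtain ⟨x, hx⟩ := DFunLike.ne_iff.1 hf
  have hgx : g x ≠ 0 := fun h ↦ hx (Subtype.ext ((LinearMap.congr_fun hg x).symm.trans h))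
  exact ⟨g, hρ.surjective_of_comp (LinearMap.surjective_of_ne_zero
    (hρ.comp_ne_zero hJ (hπ.ker_le_jacobson_smul_top x.2) hgx)), hg⟩

/-- An acyclic simple module: a simple module which is semi-Gorenstein-projective but not
projective. -/
structure IsAcyclicSimple (A : Type u) [Ring A] (S : Type u) [AddCommGroup S] [Module A S] :
    Prop where
  isSimpleModule : IsSimpleModule A S
  not_projective : ¬ Module.Projective A S
  isSemiGorensteinProjective : IsSemiGorensteinProjective A S

theorem IsAcyclicSimple.of_linearEquiv (h : IsAcyclicSimple A S) (e : S ≃ₗ[A] T) :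
    IsAcyclicSimple A T where
  isSimpleModule := have := h.isSimpleModule; .congr e.symm
  not_projective _ := h.not_projective (.of_equiv e.symm)
  isSemiGorensteinProjective := h.isSemiGorensteinProjective.of_linearEquiv e

/-- `K` is a first syzygy of `M`: the kernel of a projective cover of `M`. -/
def IsSyzygy (A : Type u) [Ring A] (K M : Type u) [AddCommGroup K] [Module A K] [AddCommGroup M]
    [Module A M] : Prop :=
  ∃ (P : Type u) (_ : AddCommGroup P) (_ : Module A P) (π : P →ₗ[A] M),
    IsProjectiveCover π ∧ Nonempty (K ≃ₗ[A] LinearMap.ker π)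

theorem IsProjectiveCover.isSyzygy {π : P →ₗ[A] M} (hπ : IsProjectiveCover π) :
    IsSyzygy A (LinearMap.ker π) M :=
  ⟨P, inferInstance, inferInstance, π, hπ, ⟨.refl A _⟩⟩

namespace IsSyzygy

theorem of_linearEquiv (h : IsSyzygy A K M) (e : K ≃ₗ[A] K') : IsSyzygy A K' M :=
  let ⟨P, _, _, π, hπ, ⟨e'⟩⟩ := h
  ⟨P, _, _, π, hπ, ⟨e.symm ≪≫ₗ e'⟩⟩

theorem projective_of_subsingleton [Subsingleton K] (h : IsSyzygy A K M) :
    Module.Projective A M := by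
  obtain ⟨P, _, _, π, hπ, ⟨e⟩⟩ := h
  have := hπ.projective
  have := e.symm.subsingleton
  exact .of_equiv (.ofBijective π
    ⟨LinearMap.ker_eq_bot.1 (Submodule.subsingleton_iff_eq_bot.1 this), hπ.surjective⟩)

variable [IsSemisimpleRing (A ⧸ Ring.jacobson A)] (hJ : Ring.jacobson A * Ring.jacobson A = ⊥)
include hJ

theorem isSemisimpleModule (h : IsSyzygy A K M) : IsSemisimpleModule A K := by
  obtain ⟨P, _, _, π, hπ, ⟨e⟩⟩ := h
  have := hπ.isSemisimpleModule_ker hJ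
  exact .congr e

theorem isAcyclicSimple_of_injective (h : IsSyzygy A K M) (hM : IsSemiGorensteinProjective A M)
    [IsSimpleModule A T] {i : T →ₗ[A] K} (hi : Function.Injective i) : IsAcyclicSimple A T := by
  have := h.isSemisimpleModule hJ
  obtain ⟨r, hr⟩ := IsSemisimpleModule.extension_property i hi LinearMap.id
  obtain ⟨P, _, _, π, hπ, ⟨e⟩⟩ := h
  have := hπ.projective
  refine ⟨inferInstance, fun _ ↦ ?_,
    ((hM.ker hπ.surjective).of_linearEquiv e.symm).of_retract i r hr⟩
  obtain ⟨t, ht⟩ := @exists_ne T (IsSimpleModule.nontrivial A T) 0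
  have hr0 : r ∘ₗ e.symm.toLinearMap = 0 := hπ.linearMap_ker_eq_zero hM _
  refine ht ?_
  calc t = r (e.symm (e (i t))) := by
        rw [e.symm_apply_apply]; exact (LinearMap.congr_fun hr t).symm
    _ = 0 := LinearMap.congr_fun hr0 (e (i t))

theorem exists_isAcyclicSimple (h : IsSyzygy A K M) (hM : IsSemiGorensteinProjective A M)
    (hproj : ¬ Module.Projective A M) : ∃ T : Submodule A K, IsAcyclicSimple A T := by
  have := h.isSemisimpleModule hJ
  have : Nontrivial K := not_subsingleton_iff_nontrivial.1 fun _ ↦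
    hproj h.projective_of_subsingleton
  obtain ⟨T, hT⟩ := IsSemisimpleModule.exists_simple_submodule A K
  exact ⟨T, h.isAcyclicSimple_of_injective hJ hM T.subtype_injective⟩

theorem injective_of_ne_zero [IsNoetherianRing A] [IsSimpleModule A S] (h : IsSyzygy A K S)
    (hS : IsSemiGorensteinProjective A S) {f : Module.End A K} (hf : f ≠ 0) :
    Function.Injective f := by
  obtain ⟨P, _, _, π, hπ, ⟨e⟩⟩ := h
  have := hπ.finite
  have hne : e.conjRingEquiv f ≠ 0 := (map_ne_zero_iff _ e.conjRingEquiv.injective).2 hf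
  obtain ⟨g, hgsurj, hg⟩ := hπ.exists_surjective_comp_subtype_eq hJ hπ hS hne
  have hginj := IsNoetherian.injective_of_surjective_endomorphism g hgsurj
  refine (injective_iff_map_eq_zero f).2 fun k hk ↦ ?_
  have hgk : g (e k) = 0 := (LinearMap.congr_fun hg (e k)).trans (by simp [hk])
  simpa using (map_eq_zero_iff g hginj).1 hgk

theorem isAcyclicSimple [IsNoetherianRing A] (h : IsSyzygy A K S) (hS : IsAcyclicSimple A S) :
    IsAcyclicSimple A K := by
  have := hS.isSimpleModule
  have := h.isSemisimpleModule hJ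
  obtain ⟨T, hT⟩ := h.exists_isAcyclicSimple hJ hS.isSemiGorensteinProjective hS.not_projective
  obtain ⟨t, ht⟩ := @exists_ne T (@IsSimpleModule.nontrivial A _ T _ _ hT.isSimpleModule) 0
  obtain ⟨r, hr⟩ := IsSemisimpleModule.extension_property T.subtype T.subtype_injective
    LinearMap.id
  have hrT : Function.RightInverse T.subtype r := LinearMap.congr_fun hr
  have hne : T.subtype ∘ₗ r ≠ 0 := fun h0 ↦ ht <| Subtype.ext <|
    (congrArg Subtype.val (hrT t)).symm.trans (LinearMap.congr_fun h0 (t : K))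
  have hinj : Function.Injective r :=
    .of_comp (f := T.subtype) (h.injective_of_ne_zero hJ hS.isSemiGorensteinProjective hne)
  exact hT.of_linearEquiv (LinearEquiv.ofBijective r ⟨hinj, hrT.surjective⟩).symm

theorem nonempty_linearEquiv [IsSimpleModule A S] [IsSimpleModule A T] [Nontrivial K]
    (hS : IsSyzygy A K S) (hT : IsSyzygy A K T) (h : IsSemiGorensteinProjective A S) :
    Nonempty (S ≃ₗ[A] T) := by
  obtain ⟨P, _, _, π, hπ, ⟨e⟩⟩ := hS
  obtain ⟨Q, _, _, ρ, hρ, ⟨e'⟩⟩ := hT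
  have hne : (e.symm ≪≫ₗ e').toLinearMap ≠ 0 := fun h0 ↦ by
    obtain ⟨k, hk⟩ := exists_ne (0 : K)
    exact hk (by simpa using LinearMap.congr_fun h0 (e k))
  obtain ⟨g, hg, -⟩ := hπ.exists_surjective_comp_subtype_eq hJ hρ h hne
  refine hπ.nonempty_linearEquiv (f := ρ ∘ₗ g) fun h0 ↦ ?_
  have := IsSimpleModule.nontrivial A T
  obtain ⟨t, ht⟩ := exists_ne (0 : T)
  obtain ⟨x, rfl⟩ := (hρ.surjective.comp hg) t
  exact ht (LinearMap.congr_fun h0 x)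

end IsSyzygy

/-- Taking syzygies is injective on isomorphism classes of acyclic simple modules, of which there
are only finitely many. -/
theorem IsAcyclicSimple.exists_isSyzygy [IsArtinianRing A] (hT : IsAcyclicSimple A T)
    (hJ : Ring.jacobson A * Ring.jacobson A = ⊥) :
    ∃ S : ModuleCat.{u} A, IsAcyclicSimple A S ∧ IsSyzygy A T S := by
  have exists_next (S : {S : ModuleCat.{u} A // IsAcyclicSimple A S}) :
      ∃ K : {S : ModuleCat.{u} A // IsAcyclicSimple A S}, IsSyzygy A K.1 S.1 := by
    have := S.2.isSimpleModule
    obtain ⟨P, _, _, π, hπ⟩ := exists_isProjectiveCover A S.1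
    exact ⟨⟨.of A (LinearMap.ker π), hπ.isSyzygy.isAcyclicSimple hJ S.2⟩, hπ.isSyzygy⟩
  choose Ω hΩ using exists_next
  let S (n : ℕ) := Ω^[n] ⟨.of A T, hT⟩
  have hS (n : ℕ) : IsSyzygy A (S (n + 1)).1 (S n).1 := by
    rw [show S (n + 1) = Ω (S n) from Function.iterate_succ_apply' _ _ _]
    exact hΩ (S n)
  have (n : ℕ) : IsSimpleModule A (S n).1 := (S n).2.isSimpleModule
  obtain ⟨i, j, hij, ⟨e⟩⟩ := exists_lt_nonempty_linearEquiv (A := A) fun n ↦ (S n).1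
  obtain ⟨k, rfl⟩ : ∃ k, j = k + i + 1 := ⟨j - i - 1, by lia⟩
  clear hij
  induction i with
  | zero => exact ⟨(S k).1, (S k).2, (hS k).of_linearEquiv e.symm⟩
  | succ i ih =>
    have := IsSimpleModule.nontrivial A (S (i + 1)).1
    obtain ⟨e'⟩ := (hS i).nonempty_linearEquiv hJ ((hS _).of_linearEquiv e.symm)
      (S i).2.isSemiGorensteinProjective
    exact ih e'

end Syzygy

section Block

variable {A : Type u} [Ring A] {P S T : Type u} [AddCommGroup P] [Module A P]
  [AddCommGroup S] [Module A S] [AddCommGroup T] [Module A T]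

/-- The right annihilator of a two-sided ideal `I`, encoded as the left ideal of all `x` with
`I * x = 0`. -/
def rightAnnihilator (I : Ideal A) [I.IsTwoSided] : Ideal A where
  carrier := {x | ∀ a ∈ I, a * x = 0}
  zero_mem' a _ := mul_zero a
  add_mem' hx hy a ha := by rw [mul_add, hx a ha, hy a ha, add_zero]
  smul_mem' b x hx a ha := by rw [smul_eq_mul, ← mul_assoc, hx _ (I.mul_mem_right b ha)]

theorem mul_rightAnnihilator (I : Ideal A) [I.IsTwoSided] : I * rightAnnihilator I = ⊥ :=
  eq_bot_iff.2 (Ideal.mul_le.2 fun a ha _ hx ↦ (Submodule.mem_bot A).2 (hx a ha))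

/-- The common annihilator of the simple modules satisfying `p`. It is the intersection of those
maximal two-sided ideals which correspond to such simple modules. -/
def simpleAnnihilator (p : ModuleCat.{u} A → Prop) : Ideal A :=
  ⨅ S : {S : ModuleCat.{u} A // IsSimpleModule A S ∧ p S}, Module.annihilator A S.1

instance (p : ModuleCat.{u} A → Prop) : (simpleAnnihilator p).IsTwoSided :=
  inferInstanceAs (⨅ S : {S : ModuleCat.{u} A // IsSimpleModule A S ∧ p S},
    Module.annihilator A S.1).IsTwoSided

section simpleAnnihilator

variable {p : ModuleCat.{u} A → Prop}

theorem simpleAnnihilator_le [IsSimpleModule A S] (h : p (.of A S)) :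
    simpleAnnihilator p ≤ Module.annihilator A S :=
  iInf_le_of_le ⟨.of A S, inferInstance, h⟩ le_rfl

theorem exists_linearEquiv_of_simpleAnnihilator_le [IsSemisimpleRing (A ⧸ Ring.jacobson A)]
    [IsSimpleModule A T] (h : simpleAnnihilator p ≤ Module.annihilator A T) :
    ∃ S : ModuleCat.{u} A, p S ∧ Nonempty (T ≃ₗ[A] S) := by
  have (S : {S : ModuleCat.{u} A // IsSimpleModule A S ∧ p S}) : IsSimpleModule A S.1 := S.2.1
  obtain ⟨S, hS⟩ := exists_linearEquiv_of_iInf_annihilator_le _ h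
  exact ⟨S.1, S.2.2, hS⟩

variable (p)

theorem simpleAnnihilator_inf_le_jacobson :
    simpleAnnihilator p ⊓ simpleAnnihilator (fun S ↦ ¬ p S) ≤ Ring.jacobson A := by
  rw [Ring.jacobson_eq_sInf_isMaximal]
  refine le_sInf fun m (hm : m.IsMaximal) a ha ↦ ?_
  have : IsSimpleModule A (A ⧸ m) := isSimpleModule_iff_isCoatom.2 (Ideal.isMaximal_def.1 hm)
  have hann : a ∈ Module.annihilator A (A ⧸ m) := by
    by_cases hp : p (.of A (A ⧸ m))
    · exact simpleAnnihilator_le hp ha.1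
    · exact simpleAnnihilator_le (p := fun S ↦ ¬ p S) hp ha.2
  exact annihilator_quotient_le m hann

theorem simpleAnnihilator_sup_eq_top [IsSemisimpleRing (A ⧸ Ring.jacobson A)]
    (hp : ∀ S T : ModuleCat.{u} A, (S ≃ₗ[A] T) → p S → p T) :
    simpleAnnihilator p ⊔ simpleAnnihilator (fun S ↦ ¬ p S) = ⊤ := by
  by_contra hne
  obtain ⟨m, hm, hle⟩ := Ideal.exists_le_maximal _ hne
  have : IsSimpleModule A (A ⧸ m) := isSimpleModule_iff_isCoatom.2 (Ideal.isMaximal_def.1 hm)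
  obtain ⟨S, hS, ⟨e⟩⟩ := exists_linearEquiv_of_simpleAnnihilator_le (p := p)
    (le_annihilator_quotient (m := m) (le_sup_left.trans hle))
  obtain ⟨T, hT, ⟨e'⟩⟩ := exists_linearEquiv_of_simpleAnnihilator_le (p := fun S ↦ ¬ p S)
    (le_annihilator_quotient (m := m) (le_sup_right.trans hle))
  exact hT (hp S T (e.symm ≪≫ₗ e') hS)

end simpleAnnihilator

/-- The common annihilator of the acyclic simple modules. -/
abbrev acyclicAnnihilator (A : Type u) [Ring A] : Ideal A :=
  simpleAnnihilator fun S : ModuleCat.{u} A ↦ IsAcyclicSimple A S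

/-- The common annihilator of the simple modules which are not acyclic. -/
abbrev nonacyclicAnnihilator (A : Type u) [Ring A] : Ideal A :=
  simpleAnnihilator fun S : ModuleCat.{u} A ↦ ¬ IsAcyclicSimple A S

theorem acyclicAnnihilator_mul_nonacyclicAnnihilator_le :
    acyclicAnnihilator A * nonacyclicAnnihilator A ≤ Ring.jacobson A :=
  Ideal.mul_le_inf.trans (simpleAnnihilator_inf_le_jacobson _)

theorem nonacyclicAnnihilator_mul_acyclicAnnihilator_le :
    nonacyclicAnnihilator A * acyclicAnnihilator A ≤ Ring.jacobson A :=
  Ideal.mul_le_inf.trans ((inf_comm _ _).trans_le (simpleAnnihilator_inf_le_jacobson _))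

theorem mul_self_sup_mul_self_eq_top_of_mul_le_jacobson {I K : Ideal A} (hsup : I ⊔ K = ⊤)
    (hIK : I * K ≤ Ring.jacobson A) (hKI : K * I ≤ Ring.jacobson A) : I * I ⊔ K * K = ⊤ := by
  by_contra hne
  obtain ⟨m, hm, hle⟩ := Ideal.exists_le_maximal _ hne
  have hJm := Ring.jacobson_le_of_isMaximal m
  refine hm.ne_top (top_le_iff.1 ?_)
  calc ⊤ = (I ⊔ K) * (I ⊔ K) := by rw [hsup, Ideal.mul_top]
    _ = I * I ⊔ K * I ⊔ (I * K ⊔ K * K) := by simp only [Ideal.mul_sup, Ideal.sup_mul]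
    _ ≤ m := sup_le (sup_le (le_sup_left.trans hle) (hKI.trans hJm))
      (sup_le (hIK.trans hJm) (le_sup_right.trans hle))

theorem IsConnectedAlgebra.eq_top_or_eq_top (hconn : IsConnectedAlgebra A) {I J : Ideal A}
    (hsup : I ⊔ J = ⊤) (hIJ : I * J = ⊥) (hJI : J * I = ⊥) : I = ⊤ ∨ J = ⊤ := by
  obtain ⟨b, hb, c, hc, hbc⟩ := Submodule.mem_sup.1 (hsup ▸ trivial : (1 : A) ∈ I ⊔ J)
  have hbac (a : A) : b * (a * c) = 0 :=
    (Submodule.mem_bot A).1 (hIJ ▸ Ideal.mul_mem_mul hb (J.mul_mem_left a hc))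
  have hcab (a : A) : c * (a * b) = 0 :=
    (Submodule.mem_bot A).1 (hJI ▸ Ideal.mul_mem_mul hc (I.mul_mem_left a hb))
  have hba (a : A) : b * a = b * (a * b) := by
    rw [← add_zero (b * (a * b)), ← hbac a, ← mul_add, ← mul_add, hbc, mul_one]
  have hab (a : A) : a * b = b * (a * b) := by
    rw [← add_zero (b * (a * b)), ← hcab a, ← add_mul, hbc, one_mul]
  have hcenter : b ∈ Subring.center A :=
    Subring.mem_center_iff.2 fun a ↦ (hab a).trans (hba a).symm
  have hidem : b * b = b := by simpa using (hba 1).symm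
  rcases hconn b hcenter hidem with rfl | rfl
  · exact .inr ((Ideal.eq_top_iff_one J).2 (by rwa [← hbc, zero_add]))
  · exact .inl ((Ideal.eq_top_iff_one I).2 hb)

section JacobsonSquareZero

variable (hJ : Ring.jacobson A * Ring.jacobson A = ⊥)
include hJ

/-- An extension `g` of `f` to the cover, multiplied by `x`, takes values in the radical: modulo a
maximal left ideal it could only factor through a simple module isomorphic to `S`, which `x`
kills. -/
theorem IsProjectiveCover.apply_mul_eq_zero [IsSemisimpleRing (A ⧸ Ring.jacobson A)]
    [IsSimpleModule A S] {π : P →ₗ[A] S} (hπ : IsProjectiveCover π)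
    (hS : IsSemiGorensteinProjective A S) (f : LinearMap.ker π →ₗ[A] A) {x : A}
    (hx : x ∈ Module.annihilator A S) (k : LinearMap.ker π) : f k * x = 0 := by
  obtain ⟨g, rfl⟩ := hS.exists_comp_subtype_eq hπ.surjective f
  let h : P →ₗ[A] A := LinearMap.toSpanSingleton A A x ∘ₗ g
  have hmem (y : P) : h y ∈ Ring.jacobson A := by
    rw [Ring.jacobson_eq_sInf_isMaximal]
    refine Submodule.mem_sInf.2 fun (m : Ideal A) (hm : m.IsMaximal) ↦ ?_
    have : IsSimpleModule A (A ⧸ m) := isSimpleModule_iff_isCoatom.2 (Ideal.isMaximal_def.1 hm)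
    by_contra hy
    have hne : m.mkQ ∘ₗ h ≠ 0 := fun h0 ↦
      hy ((Submodule.Quotient.mk_eq_zero m).1 (LinearMap.congr_fun h0 y))
    obtain ⟨e⟩ := hπ.nonempty_linearEquiv hne
    exact hy (m.mul_mem_left _ (annihilator_quotient_le m (e.annihilator_eq ▸ hx)))
  have hle : Ring.jacobson A • ⊤ ≤ LinearMap.ker h := Submodule.smul_le.2 fun a ha y _ ↦ by
    rw [LinearMap.mem_ker, map_smul, smul_eq_mul, ← Submodule.mem_bot A, ← hJ]
    exact Ideal.mul_mem_mul ha (hmem y)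
  exact hle (hπ.ker_le_jacobson_smul_top k.2)

theorem IsProjectiveCover.smul_eq_zero_of_isAcyclicSimple [IsNoetherianRing A]
    [IsSemisimpleRing (A ⧸ Ring.jacobson A)] {π : P →ₗ[A] S} (hπ : IsProjectiveCover π)
    (hS : IsAcyclicSimple A S) {a : A} (ha : a ∈ acyclicAnnihilator A * Ring.jacobson A)
    (x : P) : a • x = 0 := by
  have hker := hπ.isSyzygy.isAcyclicSimple hJ hS
  have := hS.isSimpleModule
  have := hker.isSimpleModule
  induction ha using Submodule.smul_induction_on' with
  | smul b hb c hc =>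
    have hcx : c • x ∈ LinearMap.ker π :=
      jacobson_smul_top_le_ker π (Submodule.smul_mem_smul hc trivial)
    rw [smul_eq_mul, mul_smul]
    exact congrArg Subtype.val
      (Module.mem_annihilator.1 (simpleAnnihilator_le hker hb) ⟨c • x, hcx⟩)
  | add b _ c _ hb hc => rw [add_smul, hb, hc, add_zero]

variable [IsArtinianRing A]

theorem IsAcyclicSimple.apply_mul_eq_zero (hT : IsAcyclicSimple A T) (f : T →ₗ[A] A) {x : A}
    (hx : x ∈ acyclicAnnihilator A) (t : T) : f t * x = 0 := by
  obtain ⟨S, hS, P, _, _, π, hπ, ⟨e⟩⟩ := hT.exists_isSyzygy hJ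
  have := hS.isSimpleModule
  simpa using hπ.apply_mul_eq_zero hJ hS.isSemiGorensteinProjective (f ∘ₗ e.symm.toLinearMap)
    (simpleAnnihilator_le hS hx) (e t)

theorem mul_mul_eq_zero_of_mem_nonacyclicAnnihilator {a x y : A}
    (ha : a ∈ nonacyclicAnnihilator A) (hy : y ∈ Ring.jacobson A) (hx : x ∈ acyclicAnnihilator A) :
    a * (y * x) = 0 := by
  have : IsSemisimpleModule A (Ring.jacobson A) :=
    isSemisimpleModule_of_jacobson_le_annihilator fun b hb ↦ Module.mem_annihilator.2 fun z ↦
      Subtype.ext ((Submodule.mem_bot A).1 (hJ ▸ Ideal.mul_mem_mul hb z.2))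
  have hy' : (⟨y, hy⟩ : Ring.jacobson A) ∈
      sSup {T : Submodule A (Ring.jacobson A) | IsSimpleModule A T} :=
    IsSemisimpleModule.sSup_simples_eq_top A (Ring.jacobson A) ▸ trivial
  rw [sSup_eq_iSup'] at hy'
  refine Submodule.iSup_induction _ (motive := fun y : Ring.jacobson A ↦ a * (y * x) = 0) hy'
    (fun T y hyT ↦ ?_) (by simp) fun y z hy hz ↦ by simp [add_mul, mul_add, hy, hz]
  have : IsSimpleModule A T.1 := T.2
  by_cases hT : IsAcyclicSimple A T.1
  · have hyx : (y : A) * x = 0 :=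
      hT.apply_mul_eq_zero hJ ((Ring.jacobson A).subtype ∘ₗ T.1.subtype) hx ⟨y, hyT⟩
    rw [hyx, mul_zero]
  · have hay : a • y = 0 := congrArg Subtype.val (Module.mem_annihilator.1
      (simpleAnnihilator_le (p := fun S ↦ ¬ IsAcyclicSimple A S) hT ha) ⟨y, hyT⟩)
    rw [← mul_assoc, show a * (y : A) = 0 from congrArg Subtype.val hay, zero_mul]

theorem nonacyclicAnnihilator_mul_jacobson_mul_acyclicAnnihilator :
    nonacyclicAnnihilator A * Ring.jacobson A * acyclicAnnihilator A = ⊥ := by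
  rw [mul_assoc, eq_bot_iff, Ideal.mul_le]
  intro a ha z hz
  induction hz using Submodule.smul_induction_on' with
  | smul y hy x hx =>
    exact (Submodule.mem_bot A).2 (mul_mul_eq_zero_of_mem_nonacyclicAnnihilator hJ ha hy hx)
  | add y _ z _ hy hz => rw [mul_add]; exact add_mem hy hz

theorem rightAnnihilator_sup_acyclicAnnihilator :
    rightAnnihilator (acyclicAnnihilator A * Ring.jacobson A) ⊔ acyclicAnnihilator A = ⊤ := by
  by_contra hne
  obtain ⟨m, hm, hle⟩ := Ideal.exists_le_maximal _ hne
  have : IsSimpleModule A (A ⧸ m) := isSimpleModule_iff_isCoatom.2 (Ideal.isMaximal_def.1 hm)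
  obtain ⟨S, hS, ⟨e⟩⟩ := exists_linearEquiv_of_simpleAnnihilator_le
    (p := fun S : ModuleCat.{u} A ↦ IsAcyclicSimple A S)
    (le_annihilator_quotient (m := m) (le_sup_right.trans hle))
  obtain ⟨P, _, _, π, hπ⟩ := exists_isProjectiveCover A (A ⧸ m)
  have := hπ.projective
  obtain ⟨h, rfl⟩ := Module.projective_lifting_property m.mkQ π m.mkQ_surjective
  have hrange (y : P) : h y ∈ rightAnnihilator (acyclicAnnihilator A * Ring.jacobson A) :=
    fun a ha ↦ by
      rw [← smul_eq_mul, ← map_smul,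
        hπ.smul_eq_zero_of_isAcyclicSimple hJ (hS.of_linearEquiv e.symm) ha, map_zero]
  obtain ⟨y, hy⟩ := hπ.surjective (m.mkQ 1)
  refine hm.ne_top ((Ideal.eq_top_iff_one m).2 ((Submodule.Quotient.mk_eq_zero m).1 ?_))
  exact hy.symm.trans
    ((Submodule.Quotient.mk_eq_zero m).2 (hle (Submodule.mem_sup_left (hrange y))))

theorem acyclicAnnihilator_mul_jacobson_mul_nonacyclicAnnihilator :
    acyclicAnnihilator A * Ring.jacobson A * nonacyclicAnnihilator A = ⊥ := by
  set L := rightAnnihilator (acyclicAnnihilator A * Ring.jacobson A)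
  have hle : nonacyclicAnnihilator A ≤ L ⊔ Ring.jacobson A :=
    calc nonacyclicAnnihilator A
        = nonacyclicAnnihilator A * L ⊔ nonacyclicAnnihilator A * acyclicAnnihilator A := by
          rw [← Ideal.mul_sup, rightAnnihilator_sup_acyclicAnnihilator hJ, Ideal.mul_top]
      _ ≤ L ⊔ Ring.jacobson A :=
          sup_le_sup Ideal.mul_le_right nonacyclicAnnihilator_mul_acyclicAnnihilator_le
  refine eq_bot_iff.2 ((Ideal.mul_mono_right hle).trans ?_)
  rw [Ideal.mul_sup, mul_rightAnnihilator, mul_assoc, hJ, Ideal.mul_bot, sup_bot_eq]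

theorem IsAcyclicSimple.of_isConnectedAlgebra (hconn : IsConnectedAlgebra A)
    (hS : IsAcyclicSimple A S) [IsSimpleModule A T] : IsAcyclicSimple A T := by
  have := hS.isSimpleModule
  set I := acyclicAnnihilator A
  set K := nonacyclicAnnihilator A
  have hIK : I * K ≤ Ring.jacobson A := acyclicAnnihilator_mul_nonacyclicAnnihilator_le
  have hKI : K * I ≤ Ring.jacobson A := nonacyclicAnnihilator_mul_acyclicAnnihilator_le
  have hsup : I * I ⊔ K * K = ⊤ := mul_self_sup_mul_self_eq_top_of_mul_le_jacobson
    (simpleAnnihilator_sup_eq_top _ fun _ _ e h ↦ h.of_linearEquiv e) hIK hKI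
  have hmulIK : I * I * (K * K) = ⊥ := eq_bot_iff.2 <|
    calc I * I * (K * K) = I * (I * K) * K := by simp only [mul_assoc]
      _ ≤ I * Ring.jacobson A * K := Ideal.mul_mono_left (Ideal.mul_mono_right hIK)
      _ = ⊥ := acyclicAnnihilator_mul_jacobson_mul_nonacyclicAnnihilator hJ
  have hmulKI : K * K * (I * I) = ⊥ := eq_bot_iff.2 <|
    calc K * K * (I * I) = K * (K * I) * I := by simp only [mul_assoc]
      _ ≤ K * Ring.jacobson A * I := Ideal.mul_mono_left (Ideal.mul_mono_right hKI)
      _ = ⊥ := nonacyclicAnnihilator_mul_jacobson_mul_acyclicAnnihilator hJ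
  rcases hconn.eq_top_or_eq_top hsup hmulIK hmulKI with htop | htop
  · have hann : Module.annihilator A S = ⊤ :=
      top_le_iff.1 ((htop.ge.trans Ideal.mul_le_right).trans (simpleAnnihilator_le hS))
    exact absurd (Module.annihilator_eq_top_iff.1 hann)
      (not_subsingleton_iff_nontrivial.2 (IsSimpleModule.nontrivial A S))
  · by_contra hT
    have hann : Module.annihilator A T = ⊤ :=
      top_le_iff.1 ((htop.ge.trans Ideal.mul_le_right).trans (simpleAnnihilator_le hT))
    exact absurd (Module.annihilator_eq_top_iff.1 hann)
      (not_subsingleton_iff_nontrivial.2 (IsSimpleModule.nontrivial A T))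

end JacobsonSquareZero

end Block

section Injective

variable {A : Type u} [Ring A] {B : Type u} [AddCommGroup B] [Module A B]

theorem exists_comp_inclusion_eq_of_subsingleton_ext_one {M : Type u} [AddCommGroup M] [Module A M]
    {N N' : Submodule A M} (hle : N ≤ N')
    [Subsingleton (Ext (ModuleCat.of A (N' ⧸ N.submoduleOf N')) (ModuleCat.of A B) 1)]
    (f : N →ₗ[A] B) : ∃ g : N' →ₗ[A] B, g ∘ₗ Submodule.inclusion hle = f := by
  let e : LinearMap.ker (N.submoduleOf N').mkQ ≃ₗ[A] N :=
    LinearEquiv.ofEq _ _ (Submodule.ker_mkQ _) ≪≫ₗ Submodule.submoduleOfEquivOfLe hle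
  obtain ⟨g, hg⟩ := exists_comp_subtype_eq_of_subsingleton_ext_one
    (N.submoduleOf N').mkQ_surjective (f ∘ₗ e.toLinearMap)
  exact ⟨g, LinearMap.ext fun x ↦ (LinearMap.congr_fun hg (e.symm x)).trans
    (congrArg f (e.apply_symm_apply x))⟩

theorem injective_of_subsingleton_ext_quotient_one [IsArtinianRing A]
    (h : ∀ m : Ideal A, m.IsMaximal →
      Subsingleton (Ext (ModuleCat.of A (A ⧸ m)) (ModuleCat.of A B) 1)) : Module.Injective A B := by
  refine Module.Baer.injective fun I f ↦ ?_
  obtain ⟨N, ⟨hIN, g, hg⟩, hmax⟩ := exists_maximal_of_wellFoundedGT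
    (fun N : Submodule A A ↦ ∃ (hIN : I ≤ N) (g : N →ₗ[A] B), g ∘ₗ Submodule.inclusion hIN = f)
    ⟨I, le_rfl, f, rfl⟩
  obtain rfl | hN := eq_or_ne N ⊤
  · exact ⟨g ∘ₗ Submodule.topEquiv.symm.toLinearMap, fun x hx ↦ LinearMap.congr_fun hg ⟨x, hx⟩⟩
  obtain ⟨N', hNN'⟩ := exists_covBy_of_wellFoundedLT (a := N) (by rwa [isMax_iff_eq_top])
  obtain ⟨m, hm, ⟨e⟩⟩ := isSimpleModule_iff_quot_maximal.1
    ((covBy_iff_quot_is_simple hNN'.le).1 hNN')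
  have := h m hm
  have : Subsingleton
      (Ext (ModuleCat.of A (N' ⧸ N.submoduleOf N')) (ModuleCat.of A B) 1) :=
    subsingleton_ext_of_retract (.ofIso e.toModuleIso) 1
  obtain ⟨g', hg'⟩ := exists_comp_inclusion_eq_of_subsingleton_ext_one hNN'.le g
  refine absurd (hmax ⟨hIN.trans hNN'.le, g', ?_⟩ hNN'.le) hNN'.lt.not_ge
  rw [← hg, ← hg']
  rfl

end Injective

theorem isCMFree_of_forall_not_isAcyclicSimple (A : Type u) [Ring A] [IsArtinianRing A]
    (hJ : Ring.jacobson A * Ring.jacobson A = ⊥)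
    (h : ∀ S : ModuleCat.{u} A, ¬ IsAcyclicSimple A S) : IsCMFree A := by
  refine fun M _ _ _ ↦ ⟨fun hM ↦ by_contra fun hproj ↦ ?_, fun _ ↦ .of_projective M⟩
  obtain ⟨P, _, _, π, hπ⟩ := exists_isProjectiveCover A M
  obtain ⟨T, hT⟩ :=
    hπ.isSyzygy.exists_isAcyclicSimple hJ hM.isSemiGorensteinProjective hproj
  exact h (.of A T) hT

theorem mainTheorem3_general (A : Type u) [Ring A] [IsArtinianRing A]
    (hconn : IsConnectedAlgebra A) (hrad : Ring.jacobson A * Ring.jacobson A = ⊥) :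
    IsSelfInjective A ∨ IsCMFree A := by
  by_cases hS : ∃ S : ModuleCat.{u} A, IsAcyclicSimple A S
  · obtain ⟨S, hS⟩ := hS
    refine .inl (injective_of_subsingleton_ext_quotient_one fun m hm ↦ ?_)
    have : IsSimpleModule A (A ⧸ m) := isSimpleModule_iff_isCoatom.2 (Ideal.isMaximal_def.1 hm)
    exact (hS.of_isConnectedAlgebra hrad hconn).isSemiGorensteinProjective 0
  · exact .inr (isCMFree_of_forall_not_isAcyclicSimple A hrad (not_exists.1 hS))

theorem mainTheorem3 (R : Type*) [CommRing R] [IsArtinianRing R] (A : Type u) [Ring A]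
    [Algebra R A] [Module.Finite R A] (hconn : IsConnectedAlgebra A)
    (hrad : Ring.jacobson A * Ring.jacobson A = ⊥) : IsSelfInjective A ∨ IsCMFree A :=
  have : IsArtinianRing A := isArtinian_of_tower R inferInstance
  mainTheorem3_general A hconn hrad
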